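/- Let $m\ge n\ge 1$ be integers, let $S=\mathbb{C}[x_{ij}: 1\le i\le m,\ 1\le j\le n]$ be the coordinate ring of the space of complex $m\times n$ matrices, and let $\mathcal{D}=S[\partial_{ij}]$, $\partial_{ij}=\partial/\partial x_{ij}$, be the Weyl algebra. For an $n$-element subset $K\subseteq\{1,\dots,m\}$ put $$d_K=\det(x_{ij})_{i\in K,\,1\le j\le n}\in S,\qquad \partial_K=\det(\partial_{ij})_{i\in K,\,1\le j\le n}\in\mathcal{D},\qquad D_d=\sum_K \partial_K\cdot d_K\in\mathcal{D},$$ where $\partial_K\cdot d_K$ is the product in $\mathcal{D}$. Let $s_K$ be independent commuting variables, one for each $K$, let $s=\sum_K s_K$, and let $$B=S_{\prod_K d_K}[s_K : K]\cdot d^{\underline{s}},\qquad d^{\underline{s}}=\prod_K d_K^{s_K},$$ be the free module of rank one over $S_{\prod_K d_K}[s_K: K]$ with generator the formal symbol $d^{\underline{s}}$, on which $\mathcal{D}$ acts so that the $x_{ij}$ act by multiplication and $$\partial_{ij}\cdot(g\, d^{\underline{s}})=\Bigl(\frac{\partial g}{\partial x_{ij}}+g\sum_K \frac{s_K}{d_K}\frac{\partial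 d_K}{\partial x_{ij}}\Bigr)d^{\underline{s}}\qquad(g\in S_{\prod_K d_K}[s_K: K]).$$ Then $D_d$ is $\mathrm{GL}_m\times \mathrm{GL}_n$-invariant, in the sense that it commutes in $\mathcal{D}$ with the operators $\sum_{k=1}^n x_{ik}\partial_{jk}$ ($1\le i,j\le m$) and $\sum_{k=1}^m x_{ki}\partial_{kj}$ ($1\le i,j\le n$) by which $\mathfrak{gl}_m\oplus\mathfrak{gl}_n$ acts. Moreover there is exactly one polynomial $P_d$ in one variable over $\mathbb{C}$ with $$D_d\cdot d^{\underline{s}}=P_d(s)\cdot d^{\underline{s}}\quad\text{in } B,$$ and it is $$P_d(s)=\prod_{i=m-n+1}^{m}(s+i).$$ -/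

import Mathlib

open scoped BigOperators

noncomputable section

namespace MaxMinors

/-! ### The Weyl algebra -/

section Weyl

variable (σ : Type*)

/-- The free algebra on symbols `x i` (left copy of `σ`) and `∂ i` (right copy of `σ`). -/
abbrev FreeOps : Type _ := FreeAlgebra ℂ (σ ⊕ σ)

variable {σ} in
/-- The defining relations of the Weyl algebra. -/
inductive WeylRel : FreeOps σ → FreeOps σ → Prop
  | xx (i j : σ) : WeylRel
      (FreeAlgebra.ι ℂ (Sum.inl i) * FreeAlgebra.ι ℂ (Sum.inl j))
      (FreeAlgebra.ι ℂ (Sum.inl j) * FreeAlgebra.ι ℂ (Sum.inl i))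
  | dd (i j : σ) : WeylRel
      (FreeAlgebra.ι ℂ (Sum.inr i) * FreeAlgebra.ι ℂ (Sum.inr j))
      (FreeAlgebra.ι ℂ (Sum.inr j) * FreeAlgebra.ι ℂ (Sum.inr i))
  | dx_same (i : σ) : WeylRel
      (FreeAlgebra.ι ℂ (Sum.inr i) * FreeAlgebra.ι ℂ (Sum.inl i))
      (FreeAlgebra.ι ℂ (Sum.inl i) * FreeAlgebra.ι ℂ (Sum.inr i) + 1)
  | dx_ne (i j : σ) (h : i ≠ j) : WeylRel
      (FreeAlgebra.ι ℂ (Sum.inr i) * FreeAlgebra.ι ℂ (Sum.inl j))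
      (FreeAlgebra.ι ℂ (Sum.inl j) * FreeAlgebra.ι ℂ (Sum.inr i))

/-- The Weyl algebra `ℂ[x_i, ∂_i]` of differential operators on affine space with
coordinates indexed by `σ`. -/
abbrev WeylAlgebra : Type _ := RingQuot (WeylRel (σ := σ))

namespace WeylAlgebra

variable {σ}

/-- The coordinate `x i`, as an element of the Weyl algebra. -/
def x (i : σ) : WeylAlgebra σ :=
  RingQuot.mkAlgHom ℂ WeylRel (FreeAlgebra.ι ℂ (Sum.inl i))

/-- The partial derivative `∂ i`, as an element of the Weyl algebra. -/
def pd (i : σ) : WeylAlgebra σ :=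
  RingQuot.mkAlgHom ℂ WeylRel (FreeAlgebra.ι ℂ (Sum.inr i))

theorem x_comm (i j : σ) : (x i : WeylAlgebra σ) * x j = x j * x i := by
  simpa [x] using RingQuot.mkAlgHom_rel ℂ (WeylRel.xx i j)

theorem pd_comm (i j : σ) : (pd i : WeylAlgebra σ) * pd j = pd j * pd i := by
  simpa [pd] using RingQuot.mkAlgHom_rel ℂ (WeylRel.dd i j)

theorem pd_mul_x_same (i : σ) : (pd i : WeylAlgebra σ) * x i = x i * pd i + 1 := by
  simpa [pd, x] using RingQuot.mkAlgHom_rel ℂ (WeylRel.dx_same i)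

theorem pd_mul_x_ne (i j : σ) (h : i ≠ j) : (pd i : WeylAlgebra σ) * x j = x j * pd i := by
  simpa [pd, x] using RingQuot.mkAlgHom_rel ℂ (WeylRel.dx_ne i j h)

end WeylAlgebra

open scoped IsMulCommutative in
/-- Substitution of a commuting family `y` of elements of a (noncommutative) algebra `A`
into a polynomial: the algebra homomorphism with `X i ↦ y i`. -/
def evalCommuting {σ A : Type*} [Ring A] [Algebra ℂ A] (y : σ → A)
    (hy : ∀ i j, y i * y j = y j * y i) : MvPolynomial σ ℂ →ₐ[ℂ] A :=
  haveI : IsMulCommutative (Algebra.adjoin ℂ (Set.range y)) :=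
    Algebra.isMulCommutative_adjoin ℂ (by rintro _ ⟨i, rfl⟩ _ ⟨j, rfl⟩; exact hy i j)
  (Algebra.adjoin ℂ (Set.range y)).val.comp
    (MvPolynomial.aeval fun i => ⟨y i, Algebra.subset_adjoin ⟨i, rfl⟩⟩)

open scoped IsMulCommutative in
theorem evalCommuting_X {σ A : Type*} [Ring A] [Algebra ℂ A] (y : σ → A)
    (hy : ∀ i j, y i * y j = y j * y i) (i : σ) :
    evalCommuting y hy (MvPolynomial.X i) = y i := by
  simp [evalCommuting]

namespace WeylAlgebra

variable {σ}

/-- The inclusion of the coordinate ring into the Weyl algebra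
(`p` becomes the operator "multiplication by `p`"). -/
def ofPoly : MvPolynomial σ ℂ →ₐ[ℂ] WeylAlgebra σ := evalCommuting x x_comm

/-- The constant coefficient operator `p^* = p(∂)` attached to a polynomial `p`. -/
def dualOp : MvPolynomial σ ℂ →ₐ[ℂ] WeylAlgebra σ := evalCommuting pd pd_comm

end WeylAlgebra

end Weyl

/-! ### Extending derivations to localizations and to polynomial rings -/

section Deriv

/-- An algebra homomorphism `a ↦ a + ε d(a)` to dual numbers gives a derivation `d`. -/
def derivOfDual {A : Type*} [CommRing A] [Algebra ℂ A] (φ : A →ₐ[ℂ] TrivSqZeroExt A A)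
    (h : ∀ a, (φ a).fst = a) : Derivation ℂ A A :=
  Derivation.mk' ((TrivSqZeroExt.sndHom A A).restrictScalars ℂ ∘ₗ φ.toLinearMap) (by
    intro a b
    simp [h, mul_comm])

/-- A derivation `d : A → B` along an `A`-algebra `B`, as the homomorphism
`a ↦ a + ε d(a)` to dual numbers over `B`. -/
def dualOfDeriv {A B : Type*} [CommRing A] [Algebra ℂ A] [CommRing B] [Algebra ℂ B]
    [Algebra A B] [IsScalarTower ℂ A B] (d : Derivation ℂ A B) : A →ₐ[ℂ] TrivSqZeroExt B B where
  toFun a := TrivSqZeroExt.inl (algebraMap A B a) + TrivSqZeroExt.inr (d a)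
  map_one' := by simp
  map_zero' := by simp
  map_mul' a b := by
    ext
    · simp
    · simp only [TrivSqZeroExt.snd_mul, TrivSqZeroExt.snd_add, TrivSqZeroExt.fst_add,
        TrivSqZeroExt.snd_inl, TrivSqZeroExt.snd_inr, TrivSqZeroExt.fst_inl,
        TrivSqZeroExt.fst_inr, Derivation.leibniz, Algebra.smul_def,
        MulOpposite.smul_eq_mul_unop, MulOpposite.unop_op, zero_add, add_zero]
      simp only [Algebra.algebraMap_self, RingHom.id_apply]
      ring
  map_add' a b := by
    ext <;> simp
  commutes' c := by
    rw [d.map_algebraMap, ← IsScalarTower.algebraMap_apply]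
    ext <;> simp [TrivSqZeroExt.algebraMap_eq_inl']

variable {A : Type*} [CommRing A] [Algebra ℂ A]

theorem isUnit_dualOfDeriv (g : A) (d : Derivation ℂ A (Localization.Away g))
    (y : Submonoid.powers g) : IsUnit (dualOfDeriv d (y : A)) := by
  rw [TrivSqZeroExt.isUnit_iff_isUnit_fst]
  simpa [dualOfDeriv] using IsLocalization.map_units (Localization.Away g) y

/-- The homomorphism of dual numbers inducing the extension of a derivation to `A_g`. -/
def locDual (g : A) (d : Derivation ℂ A (Localization.Away g)) :
    Localization.Away g →ₐ[ℂ] TrivSqZeroExt (Localization.Away g) (Localization.Away g) :=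
  IsLocalization.liftAlgHom (M := Submonoid.powers g) (f := dualOfDeriv d)
    (isUnit_dualOfDeriv g d)

theorem locDual_algebraMap (g : A) (d : Derivation ℂ A (Localization.Away g)) (a : A) :
    locDual g d (algebraMap A _ a) = dualOfDeriv d a := by
  simp [locDual]

theorem locDual_fst (g : A) (d : Derivation ℂ A (Localization.Away g))
    (z : Localization.Away g) : (locDual g d z).fst = z := by
  have : (TrivSqZeroExt.fstHom ℂ (Localization.Away g) (Localization.Away g)).comp
      (locDual g d) = AlgHom.id ℂ _ := by
    apply IsLocalization.algHom_ext (Submonoid.powers g)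
    ext a
    change (locDual g d (algebraMap A _ a)).fst = algebraMap A _ a
    rw [locDual_algebraMap]
    simp [dualOfDeriv]
  exact DFunLike.congr_fun this z

/-- The unique extension of a derivation of `A` to the localization `A_g`. -/
def locDeriv (g : A) (d : Derivation ℂ A A) :
    Derivation ℂ (Localization.Away g) (Localization.Away g) :=
  derivOfDual (locDual g ((Algebra.linearMap A (Localization.Away g)).compDer d))
    (locDual_fst g _)

theorem locDeriv_algebraMap (g : A) (d : Derivation ℂ A A) (a : A) :
    locDeriv g d (algebraMap A _ a) = algebraMap A _ (d a) := by
  change (locDual g _ (algebraMap A _ a)).snd = _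
  rw [locDual_algebraMap]
  simp [dualOfDeriv, Algebra.algebraMap_eq_smul_one]

theorem locDeriv_comm (g : A) (d e : Derivation ℂ A A) (h : ∀ a, d (e a) = e (d a))
    (z : Localization.Away g) :
    locDeriv g d (locDeriv g e z) = locDeriv g e (locDeriv g d z) := by
  set D := ⁅locDeriv g d, locDeriv g e⁆ with hD
  have h0 : ∀ a : A, D (algebraMap A _ a) = 0 := by
    intro a
    simp [hD, Derivation.commutator_apply, locDeriv_algebraMap, h]
  have hz : D z = 0 := by
    obtain ⟨⟨a, b⟩, hab⟩ := IsLocalization.surj (Submonoid.powers g) z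
    have hu := IsLocalization.map_units (Localization.Away g) b
    have h1 := congrArg D hab
    rw [D.leibniz, h0, h0, smul_zero, zero_add, smul_eq_mul] at h1
    exact (hu.mul_right_eq_zero).1 h1
  rw [hD, Derivation.commutator_apply, sub_eq_zero] at hz
  exact hz

/-- The derivation of `A[s_j]` acting on coefficients by `d` and killing the variables. -/
def coeffDeriv (ι : Type*) (d : Derivation ℂ A A) :
    Derivation ℂ (MvPolynomial ι A) (MvPolynomial ι A) :=
  derivOfDual
    { MvPolynomial.eval₂Hom
        ((dualOfDeriv ((Algebra.linearMap A (MvPolynomial ι A)).compDer d)).toRingHom)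
        (fun j => (TrivSqZeroExt.inl (MvPolynomial.X j) : TrivSqZeroExt (MvPolynomial ι A) (MvPolynomial ι A))) with
      commutes' := by
        intro c
        rw [IsScalarTower.algebraMap_apply ℂ A (MvPolynomial ι A)]
        simp [MvPolynomial.algebraMap_eq] }
    (by
      intro p
      induction p using MvPolynomial.induction_on with
      | C a => simp [dualOfDeriv, MvPolynomial.algebraMap_eq]
      | add p q hp hq => simpa using congrArg₂ (· + ·) hp hq
      | mul_X p j hp => simpa using congrArg (· * MvPolynomial.X j) hp)

theorem coeffDeriv_C (ι : Type*) (d : Derivation ℂ A A) (a : A) :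
    coeffDeriv ι d (MvPolynomial.C a) = MvPolynomial.C (d a) := by
  simp [coeffDeriv, derivOfDual, dualOfDeriv, MvPolynomial.algebraMap_eq]

theorem coeffDeriv_X (ι : Type*) (d : Derivation ℂ A A) (j : ι) :
    coeffDeriv ι d (MvPolynomial.X j) = 0 := by
  simp [coeffDeriv, derivOfDual]

theorem coeffDeriv_comm (ι : Type*) (d e : Derivation ℂ A A) (h : ∀ a, d (e a) = e (d a))
    (p : MvPolynomial ι A) :
    coeffDeriv ι d (coeffDeriv ι e p) = coeffDeriv ι e (coeffDeriv ι d p) := by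
  induction p using MvPolynomial.induction_on with
  | C a => simp [coeffDeriv_C, h]
  | add p q hp hq => simp [hp, hq]
  | mul_X p j hp => simp [coeffDeriv_X, hp]

end Deriv

/-! ### The `D`-module generated by the formal power `f^s` -/

section BModule

open MvPolynomial

variable {σ ι : Type*} [Fintype ι] (f : ι → MvPolynomial σ ℂ)

/-- The localization `S_{f_1 ⋯ f_r}` of `S = ℂ[x]` at the product of the `f_j`. -/
abbrev LocRing : Type _ := Localization.Away (∏ j, f j)

/-- The ring `S_{f_1 ⋯ f_r}[s_1, …, s_r]`, with one variable `s_j` for each `f_j`. -/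
abbrev CoeffRing : Type _ := MvPolynomial ι (LocRing f)

/-- The derivation `∂_i` of `S_{f_1 ⋯ f_r}[s_1, …, s_r]`, which kills all `s_j`. -/
def partialCoeff (i : σ) : Derivation ℂ (CoeffRing f) (CoeffRing f) :=
  coeffDeriv ι (locDeriv (∏ j, f j)
    ((MvPolynomial.pderiv i : Derivation ℂ (MvPolynomial σ ℂ) (MvPolynomial σ ℂ))))

/-- The inverse of `f_j` in `S_{f_1 ⋯ f_r}`. -/
def invF (j : ι) : LocRing f := Ring.inverse (algebraMap (MvPolynomial σ ℂ) (LocRing f) (f j))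

theorem isUnit_algebraMap (j : ι) :
    IsUnit (algebraMap (MvPolynomial σ ℂ) (LocRing f) (f j)) :=
  isUnit_of_dvd_unit (map_dvd _ (Finset.dvd_prod_of_mem f (Finset.mem_univ j)))
    (IsLocalization.Away.algebraMap_isUnit (∏ j, f j))

theorem algebraMap_mul_invF (j : ι) :
    algebraMap (MvPolynomial σ ℂ) (LocRing f) (f j) * invF f j = 1 :=
  Ring.mul_inverse_cancel _ (isUnit_algebraMap f j)

/-- The logarithmic derivative `∑_j s_j (∂_i f_j) / f_j` of `f^s`. -/
def powLogDeriv (i : σ) : CoeffRing f :=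
  ∑ j, X j * C (algebraMap (MvPolynomial σ ℂ) (LocRing f) (pderiv i (f j)) * invF f j)

/-- Multiplication by `x_i` on `B_s^f = S_{f_1 ⋯ f_r}[s_1, …, s_r] ⬝ f^s`,
in terms of the coefficient of `f^s`. -/
def xOp (i : σ) : Module.End ℂ (CoeffRing f) :=
  LinearMap.mulLeft ℂ (C (algebraMap (MvPolynomial σ ℂ) (LocRing f) (X i)) : CoeffRing f)

/-- The action of `∂_i` on `B_s^f`:
`∂_i (g ⬝ f^s) = (∂_i g + g ∑_j s_j (∂_i f_j) / f_j) ⬝ f^s`. -/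
def pdOp (i : σ) : Module.End ℂ (CoeffRing f) :=
  (partialCoeff f i).toLinearMap + LinearMap.mulLeft ℂ (powLogDeriv f i)

theorem xOp_apply (i : σ) (g : CoeffRing f) :
    xOp f i g = (C (algebraMap (MvPolynomial σ ℂ) (LocRing f) (X i)) * g : CoeffRing f) := rfl

theorem pdOp_apply (i : σ) (g : CoeffRing f) :
    pdOp f i g = (partialCoeff f i g + powLogDeriv f i * g : CoeffRing f) := rfl

theorem partialCoeff_C (i : σ) (p : MvPolynomial σ ℂ) :
    partialCoeff f i (C (algebraMap _ (LocRing f) p)) =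
      C (algebraMap _ (LocRing f) (pderiv i p)) := by
  rw [partialCoeff, coeffDeriv_C, locDeriv_algebraMap]

theorem pderiv_pderiv_comm (i k : σ) (a : MvPolynomial σ ℂ) :
    pderiv i (pderiv k a) = pderiv k (pderiv i a) := by
  have h : ⁅(pderiv i : Derivation ℂ (MvPolynomial σ ℂ) (MvPolynomial σ ℂ)),
      (pderiv k : Derivation ℂ (MvPolynomial σ ℂ) (MvPolynomial σ ℂ))⁆ = 0 := by
    classical
    refine MvPolynomial.derivation_ext fun l => ?_
    simp [Derivation.commutator_apply, pderiv_X, Pi.single_apply, apply_ite]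
  have := DFunLike.congr_fun h a
  rw [Derivation.commutator_apply] at this
  exact sub_eq_zero.1 this

theorem partialCoeff_comm (i k : σ) (g : CoeffRing f) :
    partialCoeff f i (partialCoeff f k g) = partialCoeff f k (partialCoeff f i g) := by
  exact coeffDeriv_comm ι _ _ (locDeriv_comm _ _ _ (pderiv_pderiv_comm i k)) g

theorem derivation_log_comm {R : Type*} [CommRing R] [Algebra ℂ R] (D E : Derivation ℂ R R)
    (u v w : R) (h : v * u = 1) (hDE : D (E u) = E (D u)) (hD : D w = 0) (hE : E w = 0) :
    D (w * (E u * v)) = E (w * (D u * v)) := by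
  simp only [Derivation.leibniz, D.leibniz_of_mul_eq_one h, E.leibniz_of_mul_eq_one h,
    smul_eq_mul, hDE, hD, hE]
  ring

theorem partialCoeff_powLogDeriv (i k : σ) :
    partialCoeff f i (powLogDeriv f k) = partialCoeff f k (powLogDeriv f i) := by
  have hX : ∀ i j, partialCoeff f i (X j) = 0 := fun i j => coeffDeriv_X ι _ j
  have hlog : ∀ i, powLogDeriv f i = ∑ j, X j *
      (partialCoeff f i (C (algebraMap _ (LocRing f) (f j))) * C (invF f j)) := fun i => by
    simp only [powLogDeriv, partialCoeff_C, C_mul]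
  rw [hlog i, hlog k, map_sum, map_sum]
  refine Finset.sum_congr rfl fun j _ => ?_
  refine derivation_log_comm _ _ _ _ _ ?_ (partialCoeff_comm f i k _) (hX i j) (hX k j)
  rw [← C_mul, mul_comm, algebraMap_mul_invF, C_1]

/-- The action of the Weyl algebra on `B_s^f`, as an algebra homomorphism. -/
def weylAction : WeylAlgebra σ →ₐ[ℂ] Module.End ℂ (CoeffRing f) :=
  RingQuot.liftAlgHom ℂ ⟨FreeAlgebra.lift ℂ (Sum.elim (xOp f) (pdOp f)), by
    intro a b h
    induction h with
    | xx i j =>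
      simp only [map_mul, FreeAlgebra.lift_ι_apply, Sum.elim_inl]
      refine LinearMap.ext fun (g : CoeffRing f) => ?_
      simp only [Module.End.mul_apply, xOp_apply]
      ring
    | dd i j =>
      simp only [map_mul, FreeAlgebra.lift_ι_apply, Sum.elim_inr]
      refine LinearMap.ext fun (g : CoeffRing f) => ?_
      simp only [Module.End.mul_apply, pdOp_apply, map_add, Derivation.leibniz, smul_eq_mul]
      rw [partialCoeff_comm f i j, partialCoeff_powLogDeriv f i j]
      ring
    | dx_same i =>
      simp only [map_mul, map_add, map_one, FreeAlgebra.lift_ι_apply, Sum.elim_inl,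
        Sum.elim_inr]
      refine LinearMap.ext fun (g : CoeffRing f) => ?_
      simp only [Module.End.mul_apply, LinearMap.add_apply, Module.End.one_apply, xOp_apply, pdOp_apply, Derivation.leibniz, smul_eq_mul, partialCoeff_C,
        pderiv_X_self, map_one, mul_one]
      ring
    | dx_ne i j hij =>
      simp only [map_mul, FreeAlgebra.lift_ι_apply, Sum.elim_inl, Sum.elim_inr]
      refine LinearMap.ext fun (g : CoeffRing f) => ?_
      simp only [Module.End.mul_apply, xOp_apply, pdOp_apply, Derivation.leibniz, smul_eq_mul,
        partialCoeff_C, pderiv_X_of_ne hij.symm, map_zero, mul_zero, add_zero]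
      ring⟩

/-- The free rank one `S_{f_1 ⋯ f_r}[s_1, …, s_r]`-module `B_s^f` with generator the formal
product `f^s = f_1^{s_1} ⋯ f_r^{s_r}`; the element `g ⬝ f^s` is represented by `g`. -/
def BModule : Type _ := CoeffRing f

instance : AddCommGroup (BModule f) := inferInstanceAs (AddCommGroup (CoeffRing f))

instance : Module (CoeffRing f) (BModule f) :=
  inferInstanceAs (Module (CoeffRing f) (CoeffRing f))

/-- The generator `f^s`. -/
def fpow : BModule f := (1 : CoeffRing f)

/-- The left module structure of `B_s^f` over the Weyl algebra, where `x_i` acts by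
multiplication and `∂_i` by `∂_i (g ⬝ f^s) = (∂_i g + g ∑_j s_j (∂_i f_j) / f_j) ⬝ f^s`. -/
instance : Module (WeylAlgebra σ) (BModule f) :=
  Module.compHom (CoeffRing f) (weylAction f).toRingHom

end BModule

/-! ### Maximal minors -/

section Minors

variable (m n : ℕ)

/-- The coordinates `x_{ij}` on `m × n` matrices are indexed by pairs. -/
abbrev Coord : Type := Fin m × Fin n

/-- The set of `n`-element subsets of `[m]`. -/
abbrev RowSet : Type := {K : Finset (Fin m) // K.card = n}

variable {m n}

/-- The maximal minor `d_K = det (x_{ij})_{i ∈ K, j ∈ [n]}`. -/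
def minor (K : RowSet m n) : MvPolynomial (Coord m n) ℂ :=
  Matrix.det (Matrix.of fun a b : Fin n => MvPolynomial.X (K.1.orderEmbOfFin K.2 a, b))

variable (m n) in
/-- The operator `D_d = ∑_K ∂_K ⬝ d_K` in the Weyl algebra, where `∂_K = d_K^*`. -/
def minorOp : WeylAlgebra (Coord m n) :=
  ∑ K : RowSet m n, WeylAlgebra.dualOp (minor K) * WeylAlgebra.ofPoly (minor K)

/-- The action map `τ` from `gl_m ⊕ gl_n` to the Weyl algebra, by polarization operators:
`(E_{ij}, 0) ↦ ∑_k x_{ik} ∂_{jk}` and `(0, E_{ij}) ↦ ∑_k x_{ki} ∂_{kj}`. -/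
def tau (a : Matrix (Fin m) (Fin m) ℂ × Matrix (Fin n) (Fin n) ℂ) :
    WeylAlgebra (Coord m n) :=
  (∑ i, ∑ j, a.1 i j • ∑ k, WeylAlgebra.x (i, k) * WeylAlgebra.pd (j, k)) +
    ∑ i, ∑ j, a.2 i j • ∑ k, WeylAlgebra.x (k, i) * WeylAlgebra.pd (k, j)

end Minors

end MaxMinors

end

namespace MaxMinors

open MvPolynomial

/-! ### Commutation relations in the Weyl algebra -/

namespace WeylAlgebra

variable {σ : Type*}

/-! Expanding each `∂_K` by the Leibniz formula and absorbing signs into the minors turns `D_d` into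
the sum over all row sequences `r : Fin n → Fin m` of `∏ a, ∂_{r(a),a}` times `det (x_{r(a),b})`
(`minorOp_eq_sum`); sequences with repeated rows contribute zero.

Invariance: commuting a linear vector field past `∂_p q` applies the field to `q` and subtracts its
transpose applied to `p`. For columns this vanishes for each `K` separately; for rows the terms
cancel after replacing one entry of `r`.

Eigenvalue: the generator satisfies `∑ k, x_{ki} ∂_{kj} v = δ_{ij} s v`. A Cayley-type step
(`sum_pd_smul_genMinor_cons`) sums over the first row of a minor of size `p + 1` and leaves the
complementary minor of size `p` times `s + m - p`. Iterating gives the product of `s + m - q` for `q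
< n`. Uniqueness holds because the powers of `∑ s_K` are linearly independent over `ℂ`. -/

theorem ofPoly_X (i : σ) : ofPoly (X i) = (x i : WeylAlgebra σ) := evalCommuting_X _ _ i

theorem dualOp_X (i : σ) : dualOp (X i) = (pd i : WeylAlgebra σ) := evalCommuting_X _ _ i

theorem pd_mul_ofPoly (i : σ) (p : MvPolynomial σ ℂ) :
    pd i * ofPoly p = ofPoly p * pd i + ofPoly (pderiv i p) := by
  classical
  induction p using MvPolynomial.induction_on with
  | C a => simp [← algebraMap_eq, Algebra.commutes]
  | add p q hp hq => simp only [map_add, mul_add, add_mul, hp, hq]; abel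
  | mul_X p j hp =>
    have hx : pd i * x j = x j * pd i + ofPoly (pderiv i (X j)) := by
      by_cases h : i = j
      · subst h; simp [pd_mul_x_same]
      · simp [pd_mul_x_ne i j h, pderiv_X_of_ne (Ne.symm h)]
    rw [map_mul, ofPoly_X, ← mul_assoc, hp, add_mul, mul_assoc, hx, Derivation.leibniz, smul_eq_mul,
      smul_eq_mul, map_add, map_mul, map_mul, ofPoly_X, mul_add, ← mul_assoc, ← ofPoly_X j,
      ← map_mul, ← map_mul, ← map_mul, ← map_mul, mul_comm (X j)]
    abel

theorem dualOp_mul_x (i : σ) (p : MvPolynomial σ ℂ) :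
    dualOp p * x i = x i * dualOp p + dualOp (pderiv i p) := by
  classical
  induction p using MvPolynomial.induction_on with
  | C a => simp [← algebraMap_eq, Algebra.commutes]
  | add p q hp hq => simp only [map_add, mul_add, add_mul, hp, hq]; abel
  | mul_X p j hp =>
    have hx : pd j * x i = x i * pd j + dualOp (pderiv i (X j)) := by
      by_cases h : i = j
      · subst h; simp [pd_mul_x_same]
      · simp [pd_mul_x_ne j i (Ne.symm h), pderiv_X_of_ne (Ne.symm h)]
    rw [map_mul, dualOp_X, mul_assoc, hx, mul_add, ← mul_assoc, hp, add_mul, Derivation.leibniz,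
      smul_eq_mul, smul_eq_mul, map_add, map_mul, map_mul, dualOp_X, mul_assoc, ← dualOp_X j,
      ← map_mul, ← map_mul, ← map_mul, ← map_mul, mul_comm (X j)]
    abel

/-- The commutator of `x_u ∂_v` with a multiplication operator. -/
theorem x_mul_pd_mul_ofPoly (u v : σ) (p : MvPolynomial σ ℂ) :
    x u * pd v * ofPoly p = ofPoly p * (x u * pd v) + ofPoly (X u * pderiv v p) := by
  rw [mul_assoc, pd_mul_ofPoly, mul_add, ← ofPoly_X u, ← mul_assoc, ← mul_assoc,
    ← map_mul, ← map_mul, ← map_mul, mul_comm (X u) p]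

/-- The commutator of `x_u ∂_v` with a constant coefficient operator. -/
theorem dualOp_mul_x_mul_pd (u v : σ) (p : MvPolynomial σ ℂ) :
    dualOp p * (x u * pd v) = x u * pd v * dualOp p + dualOp (X v * pderiv u p) := by
  rw [← mul_assoc, dualOp_mul_x, add_mul, mul_assoc, mul_assoc, ← dualOp_X v, ← map_mul,
    ← map_mul, ← map_mul, mul_comm p, mul_comm (pderiv u p)]

/-- The commutator of a linear vector field with a product `∂_p ⬝ q`. -/
theorem sum_x_mul_pd_commutator {κ : Type*} [Fintype κ] (u v : κ → σ) (p q : MvPolynomial σ ℂ) :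
    (∑ k, x (u k) * pd (v k)) * (dualOp p * ofPoly q) -
        (dualOp p * ofPoly q) * ∑ k, x (u k) * pd (v k) =
      dualOp p * ofPoly (∑ k, X (u k) * pderiv (v k) q) -
        dualOp (∑ k, X (v k) * pderiv (u k) p) * ofPoly q := by
  rw [map_sum, map_sum, Finset.sum_mul, Finset.mul_sum, Finset.mul_sum, Finset.sum_mul,
    ← Finset.sum_sub_distrib, ← Finset.sum_sub_distrib]
  refine Finset.sum_congr rfl fun k _ => ?_
  have h1 := x_mul_pd_mul_ofPoly (u k) (v k) q
  have h2 := dualOp_mul_x_mul_pd (u k) (v k) p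
  calc _ = x (u k) * pd (v k) * dualOp p * ofPoly q -
        dualOp p * (ofPoly q * (x (u k) * pd (v k))) := by simp only [mul_assoc]
    _ = (dualOp p * (x (u k) * pd (v k)) - dualOp (X (v k) * pderiv (u k) p)) * ofPoly q -
        dualOp p * (x (u k) * pd (v k) * ofPoly q - ofPoly (X (u k) * pderiv (v k) q)) := by
      rw [h1, h2, add_sub_cancel_right, add_sub_cancel_right]
    _ = _ := by
      rw [sub_mul, mul_sub, mul_assoc]
      abel

end WeylAlgebra

/-! ### Derivations and determinants -/

theorem derivation_prod {R A : Type*} [CommRing R] [CommRing A] [Algebra R A]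
    (D : Derivation R A A) {ι : Type*} [DecidableEq ι] (s : Finset ι) (f : ι → A) :
    D (∏ i ∈ s, f i) = ∑ i ∈ s, ∏ j ∈ s, Function.update f i (D (f i)) j := by
  induction s using Finset.induction_on with
  | empty => simp
  | insert a s ha ih =>
    rw [Finset.prod_insert ha, D.leibniz, ih, Finset.sum_insert ha, Finset.prod_insert ha,
      Function.update_self, smul_eq_mul, smul_eq_mul, add_comm, Finset.mul_sum]
    congr 1
    · rw [mul_comm]
      congr 1
      exact Finset.prod_congr rfl fun j hj =>
        (Function.update_of_ne (ne_of_mem_of_not_mem hj ha) _ _).symm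
    · refine Finset.sum_congr rfl fun i hi => ?_
      rw [Finset.prod_insert ha, Function.update_of_ne (ne_of_mem_of_not_mem hi ha).symm]

theorem derivation_det {R A : Type*} [CommRing R] [CommRing A] [Algebra R A]
    (D : Derivation R A A) {ι : Type*} [DecidableEq ι] [Fintype ι] (M : Matrix ι ι A) :
    D M.det = ∑ b, (M.updateCol b fun a => D (M a b)).det := by
  simp only [Matrix.det_apply, map_sum]
  rw [Finset.sum_comm]
  refine Finset.sum_congr rfl fun τ _ => ?_
  rw [Units.smul_def, map_zsmul, derivation_prod, Finset.smul_sum]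
  refine Finset.sum_congr rfl fun b _ => ?_
  rw [Units.smul_def]
  congr 1
  refine Finset.prod_congr rfl fun j _ => ?_
  by_cases h : j = b
  · subst h; simp
  · simp [h]

/-! ### Minors on arbitrary rows and columns -/

section Minors

variable {m n p : ℕ}

/-- The determinant `det (x_{r(a) c(b)})` for arbitrary sequences of rows and columns. -/
noncomputable def genMinor (r : Fin p → Fin m) (c : Fin p → Fin n) :
    MvPolynomial (Coord m n) ℂ :=
  Matrix.det (Matrix.of fun a b => X (r a, c b))

theorem minor_eq_genMinor (K : RowSet m n) :
    minor K = genMinor (K.1.orderEmbOfFin K.2) id := rfl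

theorem genMinor_comp_perm (r : Fin p → Fin m) (c : Fin p → Fin n) (π : Equiv.Perm (Fin p)) :
    genMinor (r ∘ π) c = (Equiv.Perm.sign π : ℤ) • genMinor r c := by
  have := Matrix.det_permute π (Matrix.of fun a b => (X (r a, c b) : MvPolynomial (Coord m n) ℂ))
  rw [zsmul_eq_mul]
  exact this

theorem genMinor_eq_zero_of_not_injective (r : Fin p → Fin m) (c : Fin p → Fin n)
    (h : ¬ Function.Injective r) : genMinor r c = 0 := by
  simp only [Function.Injective, not_forall] at h
  obtain ⟨a, b, hab, hne⟩ := h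
  exact Matrix.det_zero_of_row_eq hne (by ext j; simp [hab])

theorem pderiv_genMinor_of_notMem (r : Fin p → Fin m) (c : Fin p → Fin n) (i : Fin m) (j : Fin n)
    (h : ∀ b, c b ≠ j) : pderiv (i, j) (genMinor r c) = 0 := by
  rw [genMinor, derivation_det]
  refine Finset.sum_eq_zero fun b _ => Matrix.det_eq_zero_of_column_eq_zero b fun a => ?_
  have hne : ((r a, c b) : Coord m n) ≠ (i, j) := fun e => h b (congrArg Prod.snd e)
  rw [Matrix.updateCol_self, Matrix.of_apply, pderiv_X_of_ne hne]

/-- Deleting the original copy of row `r a` leaves the one put in front, so the rows of `r` appear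
up to a cycle of sign `(-1)^a`. -/
theorem genMinor_cons_succ_succAbove {p : ℕ} (r : Fin p → Fin m) (c : Fin p → Fin n) (a : Fin p) :
    genMinor ((Fin.cons (r a) r : Fin (p + 1) → Fin m) ∘ a.succ.succAbove) c =
      ((-1) ^ (a : ℕ) : ℤ) • genMinor r c := by
  obtain _ | p := p
  · exact a.elim0
  have : (Fin.cons (r a) r : Fin (p + 2) → Fin m) ∘ a.succ.succAbove =
      r ∘ a.cycleRange.symm := by
    rw [← Fin.cons_removeNth_eq_comp_cycleRange_symm]
    funext j
    refine Fin.cases ?_ (fun j => ?_) j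
    · simp
    · simp [Fin.removeNth, Fin.succ_succAbove_succ]
  rw [this, genMinor_comp_perm]
  simp [Equiv.Perm.sign_symm, Fin.sign_cycleRange]

/-- Laplace expansion along the first column: by injectivity of `c`, the complementary minors do not
involve column `c 0`. -/
theorem pderiv_genMinor_succ (r : Fin (p + 1) → Fin m) (c : Fin (p + 1) → Fin n)
    (hc : Function.Injective c) (i : Fin m) :
    pderiv (i, c 0) (genMinor r c) = ∑ a : Fin (p + 1),
      if r a = i then (-1) ^ (a : ℕ) * genMinor (r ∘ a.succAbove) (c ∘ Fin.succ) else 0 := by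
  rw [genMinor, Matrix.det_succ_column_zero, map_sum]
  refine Finset.sum_congr rfl fun a _ => ?_
  have h0 : pderiv (i, c 0) (genMinor (r ∘ a.succAbove) (c ∘ Fin.succ)) = 0 :=
    pderiv_genMinor_of_notMem _ _ _ _ fun b e => Fin.succ_ne_zero b (hc e)
  change pderiv (i, c 0) ((-1) ^ (a : ℕ) * X (r a, c 0) *
    genMinor (r ∘ a.succAbove) (c ∘ Fin.succ)) = _
  have hs : pderiv (i, c 0) ((-1) ^ (a : ℕ) : MvPolynomial (Coord m n) ℂ) = 0 := by
    rw [Derivation.leibniz_pow]; simp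
  rw [Derivation.leibniz, h0, Derivation.leibniz, hs]
  split_ifs with h
  · rw [h, pderiv_X_self]; simp [mul_comm]
  · rw [pderiv_X_of_ne fun e => h (congrArg Prod.fst e)]; simp

/-- The front row contributes once for each of the `m` values of `i`. Each of the `p` rows of `r`
contributes only when `i = r a`, with sign `(-1)^(a+1) * (-1)^a = -1`. -/
theorem sum_pderiv_genMinor_cons (r : Fin p → Fin m) (c : Fin (p + 1) → Fin n)
    (hc : Function.Injective c) :
    ∑ i, pderiv (i, c 0) (genMinor (Fin.cons i r : Fin (p + 1) → Fin m) c) =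
      ((m : ℤ) - p) • genMinor r (c ∘ Fin.succ) := by
  simp only [pderiv_genMinor_succ _ _ hc, Fin.sum_univ_succ, Fin.cons_zero, Fin.cons_succ]
  rw [Finset.sum_add_distrib, Finset.sum_comm]
  have h0 : ∀ i : Fin m, (Fin.cons i r : Fin (p + 1) → Fin m) ∘ (0 : Fin (p + 1)).succAbove = r :=
    fun i => by funext j; simp
  simp only [Finset.sum_ite_eq, Finset.mem_univ, if_true, h0, genMinor_cons_succ_succAbove]
  have h1 : ∀ a : Fin p, (-1 : MvPolynomial (Coord m n) ℂ) ^ (a.succ : ℕ) * (((-1) ^ (a : ℕ) : ℤ) •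
      genMinor r (c ∘ Fin.succ)) = -genMinor r (c ∘ Fin.succ) := fun a => by
    have : ((-1 : MvPolynomial (Coord m n) ℂ) ^ (a : ℕ)) * (-1) ^ (a : ℕ) = 1 := by
      rw [← mul_pow]; simp
    rw [zsmul_eq_mul, ← mul_assoc, Fin.val_succ, pow_succ]
    push_cast
    linear_combination (-genMinor r (c ∘ Fin.succ)) * this
  rw [Finset.sum_congr rfl fun a _ => h1 a]
  simp only [Fin.val_zero, pow_zero, one_mul, Finset.sum_const, Finset.card_univ,
    Fintype.card_fin, zsmul_eq_mul, nsmul_eq_mul]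
  push_cast
  ring

theorem genMinor_cons_eq_sum (i : Fin m) (r : Fin p → Fin m) (c : Fin (p + 1) → Fin n) :
    genMinor (Fin.cons i r : Fin (p + 1) → Fin m) c = ∑ b : Fin (p + 1),
      (-1) ^ (b : ℕ) * X (i, c b) * genMinor r (c ∘ b.succAbove) := by
  rw [genMinor, Matrix.det_succ_row_zero]
  rfl

/-- Packages a vector field as a single derivation, so that the product and determinant rules apply
to it. -/
theorem sum_mul_derivation_apply {R A κ : Type*} [CommRing R] [CommRing A] [Algebra R A]
    [Fintype κ] (g : κ → A) (D : κ → Derivation R A A) (q : A) :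
    ∑ k, g k * D k q = (∑ k, g k • D k) q := by
  rw [← Derivation.coeFnAddMonoidHom_apply, map_sum, Finset.sum_apply]
  rfl

theorem sum_X_mul_pderiv_col_X (i j : Fin n) (a : Fin m) (b : Fin n) :
    ∑ k, X (k, i) * pderiv (k, j) (X (a, b) : MvPolynomial (Coord m n) ℂ) =
      if b = j then X (a, i) else 0 := by
  classical
  simp only [pderiv_X, Pi.single_apply, Prod.mk.injEq, mul_ite, mul_one, mul_zero]
  split_ifs with h <;> simp [h]

theorem sum_X_mul_pderiv_row_X (i j : Fin m) (a : Fin m) (b : Fin n) :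
    ∑ k, X (i, k) * pderiv (j, k) (X (a, b) : MvPolynomial (Coord m n) ℂ) =
      if a = j then X (i, b) else 0 := by
  classical
  simp only [pderiv_X, Pi.single_apply, Prod.mk.injEq, mul_ite, mul_one, mul_zero]
  split_ifs with h <;> simp [h]

/-- Polarization of columns. -/
theorem sum_X_mul_pderiv_col_genMinor (r : Fin n → Fin m) (i j : Fin n) :
    ∑ k, X (k, i) * pderiv (k, j) (genMinor r id) = if i = j then genMinor r id else 0 := by
  rw [sum_mul_derivation_apply, genMinor, derivation_det]
  simp only [← sum_mul_derivation_apply, Matrix.of_apply, id, sum_X_mul_pderiv_col_X]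
  rw [Finset.sum_eq_single j]
  · simp only [↓reduceIte]
    by_cases h : i = j
    · subst h
      rw [if_pos rfl]
      congr 1
      refine Matrix.ext fun a b => ?_
      by_cases hb : b = i
      · subst hb; simp
      · simp [hb]
    · rw [if_neg h]
      refine Matrix.det_zero_of_column_eq h fun a => ?_
      simp [h]
  · intro b _ hb
    exact Matrix.det_eq_zero_of_column_eq_zero b fun a => by simp [hb]
  · simp

/-- Polarization of rows. -/
theorem sum_X_mul_pderiv_row_genMinor (r : Fin p → Fin m) (c : Fin p → Fin n) (i j : Fin m) :
    ∑ k, X (i, k) * pderiv (j, k) (genMinor r c) =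
      ∑ a, if r a = j then genMinor (Function.update r a i) c else 0 := by
  -- `derivation_det` differentiates columns; transposing makes it act on rows.
  rw [sum_mul_derivation_apply, genMinor, ← Matrix.det_transpose, derivation_det]
  simp only [← sum_mul_derivation_apply, Matrix.transpose_apply, Matrix.of_apply,
    sum_X_mul_pderiv_row_X]
  refine Finset.sum_congr rfl fun a _ => ?_
  split_ifs with h
  · rw [genMinor, ← Matrix.det_transpose]
    congr 1
    refine Matrix.ext fun b a' => ?_
    by_cases hb : b = a
    · subst hb; simp
    · simp [hb]
  · exact Matrix.det_eq_zero_of_column_eq_zero a fun b => by simp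

theorem sum_X_mul_pderiv_row_prod (r : Fin p → Fin m) (c : Fin p → Fin n) (i j : Fin m) :
    ∑ k, X (i, k) * pderiv (j, k) (∏ a, X (r a, c a) : MvPolynomial (Coord m n) ℂ) =
      ∑ a, if r a = j then ∏ b, X (Function.update r a i b, c b) else 0 := by
  rw [sum_mul_derivation_apply, derivation_prod]
  simp only [← sum_mul_derivation_apply, sum_X_mul_pderiv_row_X]
  refine Finset.sum_congr rfl fun a _ => ?_
  split_ifs with h
  · refine Finset.prod_congr rfl fun b _ => ?_
    by_cases hb : b = a
    · subst hb; simp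
    · simp [hb]
  · exact Finset.prod_eq_zero (Finset.mem_univ a) (by simp)

/-- A function of `n` rows vanishing on repeated rows is summed over row sets and permutations. -/
theorem sum_rowSet_perm {M : Type*} [AddCommMonoid M] (F : (Fin n → Fin m) → M)
    (hF : ∀ r, ¬ Function.Injective r → F r = 0) :
    ∑ K : RowSet m n, ∑ π : Equiv.Perm (Fin n), F (K.1.orderEmbOfFin K.2 ∘ π) = ∑ r, F r := by
  rw [← Fintype.sum_prod_type' (f := fun (K : RowSet m n) (π : Equiv.Perm (Fin n)) =>
    F (K.1.orderEmbOfFin K.2 ∘ π))]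
  refine Fintype.sum_of_injective
    (fun q : RowSet m n × Equiv.Perm (Fin n) => q.1.1.orderEmbOfFin q.1.2 ∘ q.2) ?_ _ _ ?_
    fun _ => rfl
  · rintro ⟨K, π⟩ ⟨L, τ⟩ h
    have hr : ∀ (K : RowSet m n) (π : Equiv.Perm (Fin n)),
        Set.range (K.1.orderEmbOfFin K.2 ∘ π) = K.1 := fun K π => by
      rw [π.surjective.range_comp, Finset.range_orderEmbOfFin]
    have hKL : K = L := by
      apply Subtype.ext
      rw [← Finset.coe_inj, ← hr K π, ← hr L τ]
      exact congrArg Set.range h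
    subst hKL
    refine Prod.ext rfl (Equiv.ext fun a => ?_)
    exact (K.1.orderEmbOfFin K.2).injective (congrFun h a)
  · intro r hr
    refine hF r fun hinj => hr ?_
    have hc : (Finset.univ.image r).card = n := by
      rw [Finset.card_image_of_injective _ hinj, Finset.card_univ, Fintype.card_fin]
    let K : RowSet m n := ⟨Finset.univ.image r, hc⟩
    have hmem : ∀ a, r a ∈ K.1 := fun a => Finset.mem_image_of_mem r (Finset.mem_univ a)
    -- The permutation sends `a` to the rank of `r a` within the image of `r`.
    let g : Fin n → Fin n := fun a => (K.1.orderIsoOfFin K.2).symm ⟨r a, hmem a⟩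
    have hg : Function.Injective g := fun a b e =>
      hinj (congrArg Subtype.val ((K.1.orderIsoOfFin K.2).symm.injective e))
    refine ⟨(K, Equiv.ofBijective g (Finite.injective_iff_bijective.1 hg)), funext fun a => ?_⟩
    change ((K.1.orderIsoOfFin K.2 (g a) : K.1) : Fin m) = r a
    simp [g]

/-- Only the `∂` factor is expanded; the sign of each permutation is the one produced by permuting
the rows of the other factor. -/
theorem minorOp_eq_sum : minorOp m n = ∑ r : Fin n → Fin m,
    WeylAlgebra.dualOp (∏ a, X (r a, a)) * WeylAlgebra.ofPoly (genMinor r id) := by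
  rw [← sum_rowSet_perm]
  · refine Finset.sum_congr rfl fun K _ => ?_
    rw [minor_eq_genMinor]
    have hdet : genMinor (K.1.orderEmbOfFin K.2) id = ∑ π : Equiv.Perm (Fin n),
        (Equiv.Perm.sign π : ℤ) • ∏ a, (X ((K.1.orderEmbOfFin K.2 ∘ π) a, a) :
          MvPolynomial (Coord m n) ℂ) := by
      rw [genMinor, Matrix.det_apply]
      rfl
    conv_lhs => enter [1]; rw [hdet, map_sum]
    rw [Finset.sum_mul]
    refine Finset.sum_congr rfl fun π _ => ?_
    rw [genMinor_comp_perm, map_zsmul, map_zsmul, smul_mul_assoc, mul_smul_comm]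
  · intro r hr
    rw [genMinor_eq_zero_of_not_injective r _ hr, map_zero, mul_zero]

end Minors

/-! ### Invariance -/

section Invariance

variable {m n p : ℕ}

/-- Replacing the value at `a` is a bijection from sequences with `r a = j` to those with `r a = i`.
-/
theorem sum_update_eq {M : Type*} [AddCommMonoid M] (B : (Fin p → Fin m) → (Fin p → Fin m) → M)
    (i j : Fin m) (a : Fin p) :
    ∑ r, (if r a = j then B r (Function.update r a i) else 0) =
      ∑ r, (if r a = i then B (Function.update r a j) r else 0) := by
  rw [← Finset.sum_filter, ← Finset.sum_filter]
  refine Finset.sum_nbij' (fun r => Function.update r a i) (fun r => Function.update r a j)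
    ?_ ?_ ?_ ?_ ?_
  · simp
  · simp
  · intro r hr
    rw [← (Finset.mem_filter.1 hr).2]
    simp
  · intro r hr
    rw [← (Finset.mem_filter.1 hr).2]
    simp
  · intro r hr
    rw [← (Finset.mem_filter.1 hr).2]
    simp

theorem commute_row_minorOp (i j : Fin m) :
    Commute (∑ k : Fin n, WeylAlgebra.x (i, k) * WeylAlgebra.pd (j, k)) (minorOp m n) := by
  rw [commute_iff_eq, ← sub_eq_zero, minorOp_eq_sum, Finset.mul_sum, Finset.sum_mul,
    ← Finset.sum_sub_distrib, Finset.sum_congr rfl fun (r : Fin n → Fin m) _ =>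
      WeylAlgebra.sum_x_mul_pd_commutator (fun k : Fin n => (i, k)) (fun k => (j, k))
        (∏ a, X (r a, a)) (genMinor r id)]
  have hprod : ∀ r : Fin n → Fin m, ∑ k, X (j, k) *
      pderiv (i, k) (∏ a, X (r a, a) : MvPolynomial (Coord m n) ℂ) =
        ∑ a, if r a = i then ∏ b, X (Function.update r a j b, b) else 0 :=
    fun r => sum_X_mul_pderiv_row_prod r id j i
  simp only [sum_X_mul_pderiv_row_genMinor, hprod, map_sum, Finset.mul_sum,
    Finset.sum_mul, apply_ite WeylAlgebra.ofPoly, apply_ite WeylAlgebra.dualOp, map_zero,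
    mul_ite, ite_mul, mul_zero, zero_mul]
  rw [Finset.sum_sub_distrib, sub_eq_zero]
  -- The two halves of the commutator agree for each fixed position `a`, after summing over `r`.
  refine (Finset.sum_comm.trans (Finset.sum_congr rfl fun a _ => ?_)).trans Finset.sum_comm
  exact sum_update_eq (fun r r' =>
    WeylAlgebra.dualOp (∏ a, X (r a, a)) * WeylAlgebra.ofPoly (genMinor r' id)) i j a

theorem commute_col_minorOp (i j : Fin n) :
    Commute (∑ k : Fin m, WeylAlgebra.x (k, i) * WeylAlgebra.pd (k, j)) (minorOp m n) := by
  refine Commute.sum_right _ _ _ fun K _ => ?_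
  rw [commute_iff_eq, ← sub_eq_zero,
    WeylAlgebra.sum_x_mul_pd_commutator (fun k => (k, i)) (fun k => (k, j)),
    minor_eq_genMinor, sum_X_mul_pderiv_col_genMinor, sum_X_mul_pderiv_col_genMinor]
  by_cases h : i = j
  · simp [h]
  · simp [h, Ne.symm h]

theorem commute_tau_minorOp (a : Matrix (Fin m) (Fin m) ℂ × Matrix (Fin n) (Fin n) ℂ) :
    Commute (tau a) (minorOp m n) :=
  .add_left
    (.sum_left _ _ _ fun i _ => .sum_left _ _ _ fun j _ => (commute_row_minorOp i j).smul_left _)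
    (.sum_left _ _ _ fun i _ => .sum_left _ _ _ fun j _ => (commute_col_minorOp i j).smul_left _)

end Invariance

/-! ### The action on semi-invariants -/

section Action

variable {m n p : ℕ} {R V : Type*} [CommRing R] [AddCommGroup V] [Module R V]
  [Module (WeylAlgebra (Coord m n)) V]

theorem pd_smul_ofPoly_smul (u : Coord m n) (q : MvPolynomial (Coord m n) ℂ) (v : V) :
    WeylAlgebra.pd u • WeylAlgebra.ofPoly q • v =
      WeylAlgebra.ofPoly (pderiv u q) • v + WeylAlgebra.ofPoly q • WeylAlgebra.pd u • v := by
  rw [← mul_smul, WeylAlgebra.pd_mul_ofPoly, add_smul, mul_smul, add_comm]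

/-- By Leibniz, differentiating the minor yields `m - p`, while differentiating `v` yields `s`
through expansion along the new row. -/
theorem sum_pd_smul_genMinor_cons (s : R) (v : V)
    (hs : ∀ (w : WeylAlgebra (Coord m n)) (u : V), w • s • u = s • w • u)
    (hv : ∀ i j : Fin n, ∑ k : Fin m, WeylAlgebra.x (k, i) • WeylAlgebra.pd (k, j) • v =
      if i = j then s • v else 0)
    (r : Fin p → Fin m) (c : Fin (p + 1) → Fin n) (hc : Function.Injective c) :
    ∑ i, WeylAlgebra.pd (i, c 0) •
        WeylAlgebra.ofPoly (genMinor (Fin.cons i r : Fin (p + 1) → Fin m) c) • v =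
      (s + ((m : R) - p)) • WeylAlgebra.ofPoly (genMinor r (c ∘ Fin.succ)) • v := by
  simp only [pd_smul_ofPoly_smul]
  rw [Finset.sum_add_distrib, ← Finset.sum_smul, ← map_sum, sum_pderiv_genMinor_cons r c hc]
  have h : ∑ i, WeylAlgebra.ofPoly (genMinor (Fin.cons i r : Fin (p + 1) → Fin m) c) •
      WeylAlgebra.pd (i, c 0) • v = s • WeylAlgebra.ofPoly (genMinor r (c ∘ Fin.succ)) • v := by
    -- Summing over `i` assembles the column field from `c b` to `c 0`, which kills `v` unless `c b
    -- = c 0`, that is, `b = 0`.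
    have hb : ∀ b : Fin (p + 1), ∑ i : Fin m, WeylAlgebra.ofPoly
        ((-1) ^ (b : ℕ) * X (i, c b) * genMinor r (c ∘ b.succAbove)) •
          WeylAlgebra.pd (i, c 0) • v =
        if b = 0 then WeylAlgebra.ofPoly (genMinor r (c ∘ Fin.succ)) • s • v else 0 := by
      intro b
      have : ∀ i : Fin m, WeylAlgebra.ofPoly
          ((-1) ^ (b : ℕ) * X (i, c b) * genMinor r (c ∘ b.succAbove)) •
            WeylAlgebra.pd (i, c 0) • v =
          WeylAlgebra.ofPoly ((-1) ^ (b : ℕ) * genMinor r (c ∘ b.succAbove)) •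
            WeylAlgebra.x (i, c b) • WeylAlgebra.pd (i, c 0) • v := fun i => by
        rw [← WeylAlgebra.ofPoly_X, ← mul_smul (WeylAlgebra.ofPoly _) (WeylAlgebra.ofPoly _),
          ← map_mul, mul_right_comm]
      rw [Finset.sum_congr rfl fun i _ => this i, ← Finset.smul_sum, hv]
      by_cases h0 : b = 0
      · subst h0
        simp
      · rw [if_neg (hc.ne h0), if_neg h0, smul_zero]
    simp only [genMinor_cons_eq_sum, map_sum, Finset.sum_smul]
    rw [Finset.sum_comm, Finset.sum_congr rfl fun b _ => hb b, Finset.sum_ite_eq' ,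
      if_pos (Finset.mem_univ _), hs]
  rw [h, map_zsmul, add_smul, add_comm, smul_assoc]
  congr 1
  rw [← Int.cast_smul_eq_zsmul R]
  push_cast
  rfl

/-- Induction on the size, peeling off the first entry of `r`. A general injective `c` is needed
because the inductive step passes to `c ∘ Fin.succ`. -/
theorem sum_dualOp_smul_genMinor (s : R) (v : V)
    (hs : ∀ (w : WeylAlgebra (Coord m n)) (u : V), w • s • u = s • w • u)
    (hv : ∀ i j : Fin n, ∑ k : Fin m, WeylAlgebra.x (k, i) • WeylAlgebra.pd (k, j) • v =
      if i = j then s • v else 0)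
    (c : Fin p → Fin n) (hc : Function.Injective c) :
    ∑ r : Fin p → Fin m, WeylAlgebra.dualOp (∏ a, X (r a, c a)) •
        WeylAlgebra.ofPoly (genMinor r c) • v =
      (∏ q ∈ Finset.range p, (s + ((m : R) - q))) • v := by
  induction p with
  | zero => simp [genMinor]
  | succ p ih =>
    have hs' : ∀ (w : WeylAlgebra (Coord m n)) (u : V),
        w • (s + ((m : R) - p)) • u = (s + ((m : R) - p)) • w • u := fun w u => by
      simp only [add_smul, sub_smul, Nat.cast_smul_eq_nsmul, smul_add, smul_sub, hs]
      rw [smul_comm w m, smul_comm w p]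
    rw [← (Fin.consEquiv fun _ : Fin (p + 1) => Fin m).sum_comp, Fintype.sum_prod_type_right,
      Finset.prod_range_succ, mul_comm, mul_smul,
      ← ih (c ∘ Fin.succ) (hc.comp (Fin.succ_injective p)), Finset.smul_sum]
    refine Finset.sum_congr rfl fun r _ => ?_
    rw [← hs', ← sum_pd_smul_genMinor_cons s v hs hv r c hc, Finset.smul_sum]
    refine Finset.sum_congr rfl fun i _ => ?_
    rw [← WeylAlgebra.dualOp_X, ← mul_smul (WeylAlgebra.dualOp _) (WeylAlgebra.dualOp _),
      ← map_mul, mul_comm, Fin.prod_univ_succ]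
    rfl

theorem minorOp_smul_of_semiinvariant (s : R) (v : V)
    (hs : ∀ (w : WeylAlgebra (Coord m n)) (u : V), w • s • u = s • w • u)
    (hv : ∀ i j : Fin n, ∑ k : Fin m, WeylAlgebra.x (k, i) • WeylAlgebra.pd (k, j) • v =
      if i = j then s • v else 0) :
    minorOp m n • v = (∏ q ∈ Finset.range n, (s + ((m : R) - q))) • v := by
  rw [← sum_dualOp_smul_genMinor s v hs hv id Function.injective_id, minorOp_eq_sum,
    Finset.sum_smul]
  exact Finset.sum_congr rfl fun r _ => mul_smul _ _ _

end Action

/-! ### The module generated by the formal power -/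

section BModule

variable {σ ι : Type*} [Fintype ι] (f : ι → MvPolynomial σ ℂ)

theorem weylAction_x (i : σ) : weylAction f (WeylAlgebra.x i) = xOp f i := by
  simp [weylAction, WeylAlgebra.x]

theorem weylAction_pd (i : σ) : weylAction f (WeylAlgebra.pd i) = pdOp f i := by
  simp [weylAction, WeylAlgebra.pd]

theorem x_smul (i : σ) (v : BModule f) : WeylAlgebra.x i • v =
    (C (algebraMap (MvPolynomial σ ℂ) (LocRing f) (X i)) : CoeffRing f) • v :=
  LinearMap.congr_fun (weylAction_x f i) (show CoeffRing f from v)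

theorem pd_smul_fpow (i : σ) : WeylAlgebra.pd i • fpow f = powLogDeriv f i • fpow f := by
  refine (LinearMap.congr_fun (weylAction_pd f i) (1 : CoeffRing f)).trans ?_
  rw [pdOp_apply, Derivation.map_one_eq_zero, zero_add]
  rfl

/-- It suffices to check generators: `∂_i` commutes with `s` because its derivation part kills `s`
and the rest is multiplication. -/
theorem weyl_smul_comm (s : CoeffRing f) (hs : ∀ i, partialCoeff f i s = 0)
    (w : WeylAlgebra σ) (v : BModule f) : w • s • v = s • w • v := by
  obtain ⟨a, rfl⟩ := RingQuot.mkAlgHom_surjective ℂ WeylRel w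
  induction a using FreeAlgebra.induction generalizing v with
  | grade0 c =>
    rw [AlgHom.commutes]
    have h : ∀ u : BModule f, (algebraMap ℂ (WeylAlgebra σ) c) • u =
        (algebraMap ℂ (CoeffRing f) c) • u := fun u =>
      (LinearMap.congr_fun ((weylAction f).commutes c) (show CoeffRing f from u)).trans
        (Algebra.smul_def c (show CoeffRing f from u))
    rw [h, h, smul_comm]
  | grade1 u =>
    rcases u with i | i
    · change WeylAlgebra.x i • s • v = s • WeylAlgebra.x i • v
      rw [x_smul, x_smul, smul_comm]
    · have h : ∀ u : CoeffRing f, weylAction f (WeylAlgebra.pd i) u =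
          partialCoeff f i u + powLogDeriv f i * u := fun u => by rw [weylAction_pd, pdOp_apply]
      let g : CoeffRing f := v
      change weylAction f (WeylAlgebra.pd i) (s * g) = s * weylAction f (WeylAlgebra.pd i) g
      rw [h, h, Derivation.leibniz, hs, smul_eq_mul, smul_zero]
      ring
  | mul a b ha hb => rw [map_mul, mul_smul, mul_smul, hb, ha]
  | add a b ha hb => rw [map_add, add_smul, add_smul, ha, hb, smul_add]

theorem partialCoeff_sum_X (i : σ) : partialCoeff f i (∑ j, X j) = 0 := by
  rw [map_sum]
  exact Finset.sum_eq_zero fun j _ => coeffDeriv_X ι _ j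

/-- A linear vector field for which all `f_j` have the same eigenvalue `e` acts on `f^s` by
`e ∑_j s_j`. -/
theorem sum_x_smul_pd_smul_fpow {κ : Type*} [Fintype κ] (u v : κ → σ) (e : ℂ)
    (h : ∀ j, ∑ k, X (u k) * pderiv (v k) (f j) = C e * f j) :
    ∑ k, WeylAlgebra.x (u k) • WeylAlgebra.pd (v k) • fpow f =
      (C (algebraMap (MvPolynomial σ ℂ) (LocRing f) (C e)) * ∑ j, X j : CoeffRing f) • fpow f := by
  simp only [pd_smul_fpow, x_smul, ← mul_smul]
  rw [← Finset.sum_smul]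
  congr 1
  simp only [powLogDeriv, Finset.mul_sum]
  rw [Finset.sum_comm]
  refine Finset.sum_congr rfl fun j _ => ?_
  have hj : ∑ k, (algebraMap (MvPolynomial σ ℂ) (LocRing f) (X (u k)) *
      (algebraMap (MvPolynomial σ ℂ) (LocRing f) (pderiv (v k) (f j)) * invF f j)) =
      algebraMap (MvPolynomial σ ℂ) (LocRing f) (C e) := by
    simp only [← mul_assoc, ← map_mul]
    rw [← Finset.sum_mul, ← map_sum, h j, map_mul, mul_assoc, algebraMap_mul_invF, mul_one]
  rw [← hj, map_sum, Finset.sum_mul]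
  refine Finset.sum_congr rfl fun k _ => ?_
  simp only [map_mul]
  ring

/-- Setting all variables but one to zero turns the map into the inclusion of `ℂ[X]` in `A[X]`. -/
theorem aeval_sum_X_injective {ι A : Type*} [Fintype ι] [Nonempty ι] [CommRing A] [Nontrivial A]
    [Algebra ℂ A] :
    Function.Injective (Polynomial.aeval (∑ j, X j : MvPolynomial ι A) : Polynomial ℂ →ₐ[ℂ] _) := by
  classical
  obtain ⟨j₀⟩ := ‹Nonempty ι›
  let φ : MvPolynomial ι A →ₐ[ℂ] Polynomial A :=
    (aeval (Pi.single j₀ (Polynomial.X : Polynomial A))).restrictScalars ℂ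
  have hφ : φ.comp (Polynomial.aeval (∑ j, X j : MvPolynomial ι A)) =
      Polynomial.mapAlgHom (Algebra.ofId ℂ A) := by
    refine Polynomial.algHom_ext ?_
    simp [φ]
  have hinj : Function.Injective (φ.comp (Polynomial.aeval (∑ j, X j : MvPolynomial ι A))) := by
    rw [hφ]
    exact Polynomial.map_injective _ (algebraMap ℂ A).injective
  exact Function.Injective.of_comp (f := φ) hinj

end BModule

/-! ### Nonvanishing of the minors and the value of the polynomial -/

section Minors

variable {m n : ℕ}

theorem minor_ne_zero (K : RowSet m n) : minor K ≠ 0 := by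
  intro h
  -- Evaluate at the 0-1 matrix whose rows in `K` form the identity.
  have h1 := congrArg (MvPolynomial.eval fun u : Coord m n =>
    if u.1 = K.1.orderEmbOfFin K.2 u.2 then (1 : ℂ) else 0) h
  rw [minor, RingHom.map_det, map_zero] at h1
  have : (MvPolynomial.eval fun u : Coord m n =>
      if u.1 = K.1.orderEmbOfFin K.2 u.2 then (1 : ℂ) else 0).mapMatrix
      (Matrix.of fun a b : Fin n => X (K.1.orderEmbOfFin K.2 a, b)) = 1 := by
    ext a b
    simp [Matrix.one_apply]
  rw [this, Matrix.det_one] at h1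
  exact one_ne_zero h1

/-- Needed for uniqueness: over the zero ring every polynomial would satisfy the equation. -/
theorem nontrivial_locRing_minor : Nontrivial (LocRing (minor (m := m) (n := n))) := by
  have h0 : ∏ K : RowSet m n, minor K ≠ 0 := Finset.prod_ne_zero_iff.2 fun K _ => minor_ne_zero K
  exact (IsLocalization.injective (LocRing (minor (m := m) (n := n)))
    (powers_le_nonZeroDivisors_of_noZeroDivisors h0)).nontrivial

theorem minorOp_smul_fpow (hmn : n ≤ m) :
    minorOp m n • fpow (minor (m := m) (n := n)) =
      (Polynomial.aeval (∑ K : RowSet m n, X K : CoeffRing (minor (m := m) (n := n)))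
        (∏ i ∈ Finset.Icc (m - n + 1) m, (Polynomial.X + Polynomial.C (i : ℂ)))) •
          fpow (minor (m := m) (n := n)) := by
  rw [minorOp_smul_of_semiinvariant (∑ K : RowSet m n, X K) _
    (weyl_smul_comm _ _ (partialCoeff_sum_X _))]
  · congr 1
    rw [map_prod]
    -- The factor `s + m - q` is `s + i` with `i = m - q`; the range `q < n` becomes `m - n + 1 ≤ i
    -- ≤ m`, and `n ≤ m` keeps the subtraction exact.
    refine Finset.prod_nbij' (fun q => m - q) (fun i => m - i) ?_ ?_ ?_ ?_ ?_
    · intro q hq; simp only [Finset.mem_range, Finset.mem_Icc] at hq ⊢; omega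
    · intro q hq; simp only [Finset.mem_range, Finset.mem_Icc] at hq ⊢; omega
    · intro q hq; simp only [Finset.mem_range] at hq; omega
    · intro q hq; simp only [Finset.mem_Icc] at hq; omega
    · intro q hq
      simp only [Finset.mem_range] at hq
      simp [Nat.cast_sub (show q ≤ m by omega)]
  · intro i j
    rw [sum_x_smul_pd_smul_fpow _ (fun k => (k, i)) (fun k => (k, j)) (if i = j then 1 else 0)]
    · split_ifs <;> simp
    · intro K
      rw [minor_eq_genMinor, sum_X_mul_pderiv_col_genMinor]
      split_ifs <;> simp

end Minors

end MaxMinors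

open MaxMinors in
/-- The polynomial `P_d` is the unique `P ∈ ℂ[s]` with `D_d ⬝ d^s = P(s) ⬝ d^s` in `B_s^d`,
where `s = ∑_K s_K`. -/
theorem theorem3p5 (m n : ℕ) (hn : 1 ≤ n) (hmn : n ≤ m) :
    (∀ a : Matrix (Fin m) (Fin m) ℂ × Matrix (Fin n) (Fin n) ℂ,
      tau a * minorOp m n - minorOp m n * tau a = 0) ∧
    ∀ P : Polynomial ℂ,
      minorOp m n • fpow (minor (m := m) (n := n)) =
          (Polynomial.aeval (∑ K : RowSet m n, MvPolynomial.X K :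
            CoeffRing (minor (m := m) (n := n))) P) • fpow (minor (m := m) (n := n)) ↔
        P = ∏ i ∈ Finset.Icc (m - n + 1) m, (Polynomial.X + Polynomial.C (i : ℂ)) := by
  refine ⟨fun a => sub_eq_zero.2 (commute_tau_minorOp a).eq, fun P => ?_⟩
  have : Nontrivial (LocRing (minor (m := m) (n := n))) := nontrivial_locRing_minor
  have : Nonempty (RowSet m n) := by
    obtain ⟨K, -, hK⟩ := Finset.exists_subset_card_eq (s := (Finset.univ : Finset (Fin m)))
      (n := n) (by simpa using hmn)
    exact ⟨⟨K, hK⟩⟩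
  rw [minorOp_smul_fpow hmn]
  constructor
  · intro h
    refine (aeval_sum_X_injective (ι := RowSet m n)
      (A := LocRing (minor (m := m) (n := n))) ?_).symm
    -- The generator is `1` in the underlying ring, so scalars can be read off from the module
    -- elements.
    have h' : ∀ g : CoeffRing (minor (m := m) (n := n)),
        g • fpow (minor (m := m) (n := n)) = g := fun g => mul_one g
    rw [h', h'] at h
    exact h
  · rintro rfl
    rfl
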